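/- Fix $n \ge 1$ and propositional variables $p_1,\dots,p_n$. A model is a triple $M=(M,\le,c)$ where $(M,\le)$ is a partially ordered set and $c : M \to \{0,1\}^n$ is order-preserving (for the pointwise order on $\{0,1\}^n$). A $(\wedge,\to)$-formula is a formula built from $p_1,\dots,p_n$ using only $\wedge$ and $\to$. For such a formula $\varphi$ let $v(\varphi)\subseteq M$ be the set of points satisfying $\varphi$ in the Kripke semantics: $v(p_i)=\{x : c(x)_i=1\}$, $v(\varphi\wedge\psi)=v(\varphi)\cap v(\psi)$, and $v(\varphi\to\psi)=\{x : \text{for all } y\ge x, \text{ if } y\in v(\varphi) \text{ then } y\in v(\psi)\}$. For a variable $q$, a $q$-border point is a maximal element of $M\setminus v(q)$. The model $M$ has borders if for every variable $p$ and every $x\in M\setminus v(p)$ there is a $p$-border point $u\ge x$. A point is separated if it is a $q$-border point for some variable $q$. $M^s$ denotes the set of separated points of $M$ with the restricted order and colouring. Two points of a model are bisimilar if they are related by some bisimulation on it, i.e. a relation $R$ such that $x\mathrel R y$ implies: $c(x)=c(y)$; for every $x'\ge x$ there is $y'\ge y$ with $x'\mathrel R y'$; and for every $y'\ge y$ there is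 $x'\ge x$ with $x'\mathrel R y'$. Theorem 3.14. Let $M$ be a model with borders and let $U\subseteq M$ be an up-set. The following are equivalent: 1. There exists a $(\wedge,\to)$-formula $\varphi$ such that $v(\varphi)=U$. 2. For all $x\in M$: if for every $z\in M^s$ with $z\ge x$ there exists $y\in U\cap M^s$ that is bisimilar to $z$ in $M^s$, then $x\in U$. 3. For all $x\in M$: (a) if all separated points $z\ge x$ are in $U$, then $x\in U$; and (b) if $x\in M^s$ and there exists $x'\in U\cap M^s$ that is bisimilar to $x$ in $M^s$, then $x\in U$. -/

import Mathlib

namespace MeetImp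

/-- `(∧,→)`-formulas over the propositional variables `p_1, …, p_n`: the propositional formulas
built from variables using only conjunction and implication. -/
inductive Formula (n : ℕ) : Type
  | var : Fin n → Formula n
  | and : Formula n → Formula n → Formula n
  | imp : Formula n → Formula n → Formula n

/-- A colouring of a frame (poset) `M`: an order-preserving map `M → 2^n`, where `2^n` has the
pointwise order. A model on `n` variables is a poset together with a colouring. -/
abbrev Colouring (n : ℕ) (M : Type*) [PartialOrder M] := M →o (Fin n → Bool)

variable {n : ℕ} {M : Type*} [PartialOrder M]

/-- The Kripke valuation: `v c φ` is the set of points of the model `(M, ≤, c)` satisfying `φ`. -/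
def v (c : Colouring n M) : Formula n → Set M
  | .var p => {x | c x p = true}
  | .and φ ψ => v c φ ∩ v c ψ
  | .imp φ ψ => {x | ∀ y, x ≤ y → y ∈ v c φ → y ∈ v c ψ}

/-- A border point of `A` is a maximal element of the complement of `A`. -/
def IsBorderPoint (A : Set M) (u : M) : Prop :=
  Maximal (fun x => x ∉ A) u

/-- A model has borders if, for every variable `p`, every point at which `p` fails lies below
(or is equal to) a `p`-border point. -/
def HasBorders (c : Colouring n M) : Prop :=
  ∀ (p : Fin n) (x : M), x ∉ v c (.var p) → ∃ u, x ≤ u ∧ IsBorderPoint (v c (.var p)) u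

/-- A point is separated if it is a `q`-border point for some variable `q`. -/
def IsSeparated (c : Colouring n M) (x : M) : Prop :=
  ∃ q : Fin n, IsBorderPoint (v c (.var q)) x

/-- The set of separated points `M^s`, with the order induced from `M`. -/
abbrev Sep (c : Colouring n M) : Type _ := {x : M // IsSeparated c x}

/-- The colouring of the submodel `M^s` of separated points: the restriction of `c`. -/
def sepColouring (c : Colouring n M) : Colouring n (Sep c) :=
  c.comp (OrderHom.Subtype.val (IsSeparated c))

/-- A bisimulation on a model: related points have the same colour, and the back and forth
conditions hold with respect to the order. -/
structure IsBisimulation (c : Colouring n M) (R : M → M → Prop) : Prop where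
  colour : ∀ {x y}, R x y → c x = c y
  forth : ∀ {x y x'}, R x y → x ≤ x' → ∃ y', y ≤ y' ∧ R x' y'
  back : ∀ {x y y'}, R x y → y ≤ y' → ∃ x', x ≤ x' ∧ R x' y'

/-- Two points of a model are bisimilar if some bisimulation on the model relates them. -/
def Bisimilar (c : Colouring n M) (x y : M) : Prop :=
  ∃ R : M → M → Prop, IsBisimulation c R ∧ R x y

end MeetImp

namespace MeetImp

variable {n : ℕ} {M : Type*} [PartialOrder M] {c : Colouring n M}

/-! Borders push every failure of a formula up to a separated point, so truth sets are determined by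
`M^s` and respect bisimilarity there; this gives 1 → 2. The bisimulation back condition and upward
closure of `U` give 2 → 3. For 3 → 1, strict chains in `M^s` have at most `n` points, since each
strict step up turns some variable true. Hence finitely many formulas include, for each separated
`z`, one that fails exactly at the separated points below a bisimilar copy of `z`. The conjunction
of those true on `U ∩ M^s` defines `U`. -/

theorem isUpperSet_v (c : Colouring n M) (φ : Formula n) : IsUpperSet (v c φ) := by
  induction φ with
  | var p =>
    intro x y hxy hx
    have h := c.monotone hxy p
    have hx : c x p = true := hx
    rw [hx] at h
    exact top_le_iff.mp h
  | and φ ψ ihφ ihψ => exact ihφ.inter ihψ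
  | imp φ ψ => exact fun x y hxy hx z hz => hx z (hxy.trans hz)

/-- In a model with borders, the failure of a formula is witnessed at a separated point above. -/
theorem HasBorders.exists_sep_notMem (hM : HasBorders c) (φ : Formula n) {x : M}
    (hx : x ∉ v c φ) : ∃ z : Sep c, x ≤ z.1 ∧ z.1 ∉ v c φ := by
  induction φ generalizing x with
  | var p =>
    obtain ⟨u, hxu, hu⟩ := hM p x hx
    exact ⟨⟨u, p, hu⟩, hxu, hu.prop⟩
  | and φ ψ ihφ ihψ =>
    by_cases h : x ∈ v c φ
    · obtain ⟨z, hxz, hz⟩ := ihψ fun h' => hx ⟨h, h'⟩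
      exact ⟨z, hxz, fun h' => hz h'.2⟩
    · obtain ⟨z, hxz, hz⟩ := ihφ h
      exact ⟨z, hxz, fun h' => hz h'.1⟩
  | imp φ ψ _ ihψ =>
    have ⟨y, hxy, hφ, hψ⟩ : ∃ y, x ≤ y ∧ y ∈ v c φ ∧ y ∉ v c ψ := by
      by_contra! h
      exact hx h
    obtain ⟨z, hyz, hz⟩ := ihψ hψ
    exact ⟨z, hxy.trans hyz, fun h => hz (h z.1 le_rfl (isUpperSet_v c φ hyz hφ))⟩

theorem Bisimilar.refl (c : Colouring n M) (x : M) : Bisimilar c x x :=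
  ⟨Eq, ⟨by rintro x _ rfl; rfl, by rintro x _ x' rfl h; exact ⟨x', h, rfl⟩,
    by rintro x _ x' rfl h; exact ⟨x', h, rfl⟩⟩, rfl⟩

theorem Bisimilar.symm {x y : M} : Bisimilar c x y → Bisimilar c y x := by
  rintro ⟨R, hR, h⟩
  refine ⟨fun a b => R b a, ⟨fun h => (hR.colour h).symm, fun h h' => ?_, fun h h' => ?_⟩, h⟩
  · exact hR.back h h'
  · exact hR.forth h h'

theorem Bisimilar.colour_eq {x y : M} : Bisimilar c x y → c x = c y := by
  rintro ⟨R, hR, h⟩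
  exact hR.colour h

theorem Bisimilar.forth {x y x' : M} (h : Bisimilar c x y) (hx : x ≤ x') :
    ∃ y', y ≤ y' ∧ Bisimilar c x' y' := by
  obtain ⟨R, hR, h⟩ := h
  obtain ⟨y', hy, h'⟩ := hR.forth h hx
  exact ⟨y', hy, R, hR, h'⟩

theorem Bisimilar.back {x y y' : M} (h : Bisimilar c x y) (hy : y ≤ y') :
    ∃ x', x ≤ x' ∧ Bisimilar c x' y' := by
  obtain ⟨x', hx, h'⟩ := h.symm.forth hy
  exact ⟨x', hx, h'.symm⟩

/-- To prove two points bisimilar it suffices to match their colours and the points strictly above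
them. -/
theorem Bisimilar.of_lt {x y : M} (hc : c x = c y)
    (forth : ∀ x', x < x' → ∃ y', y ≤ y' ∧ Bisimilar c x' y')
    (back : ∀ y', y < y' → ∃ x', x ≤ x' ∧ Bisimilar c x' y') : Bisimilar c x y := by
  refine ⟨fun a b => Bisimilar c a b ∨ (a = x ∧ b = y), ⟨?_, ?_, ?_⟩, .inr ⟨rfl, rfl⟩⟩
  · rintro a b (h | ⟨rfl, rfl⟩)
    exacts [h.colour_eq, hc]
  · rintro a b a' (h | ⟨rfl, rfl⟩) ha
    · obtain ⟨b', hb, h'⟩ := h.forth ha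
      exact ⟨b', hb, .inl h'⟩
    · obtain rfl | ha := ha.eq_or_lt
      · exact ⟨b, le_rfl, .inr ⟨rfl, rfl⟩⟩
      · obtain ⟨b', hb, h'⟩ := forth a' ha
        exact ⟨b', hb, .inl h'⟩
  · rintro a b b' (h | ⟨rfl, rfl⟩) hb
    · obtain ⟨a', ha, h'⟩ := h.back hb
      exact ⟨a', ha, .inl h'⟩
    · obtain rfl | hb := hb.eq_or_lt
      · exact ⟨a, le_rfl, .inr ⟨rfl, rfl⟩⟩
      · obtain ⟨a', ha, h'⟩ := back b' hb
        exact ⟨a', ha, .inl h'⟩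

/-- Bisimilarity in the submodel of separated points preserves truth in the whole model. -/
theorem Bisimilar.mem_v (hM : HasBorders c) (φ : Formula n) {x y : Sep c}
    (h : Bisimilar (sepColouring c) x y) (hx : x.1 ∈ v c φ) : y.1 ∈ v c φ := by
  induction φ generalizing x y with
  | var p => exact (congrFun h.colour_eq p).symm.trans hx
  | and φ ψ ihφ ihψ => exact ⟨ihφ h hx.1, ihψ h hx.2⟩
  | imp φ ψ ihφ ihψ =>
    intro w hyw hwφ
    by_contra hwψ
    obtain ⟨z, hwz, hz⟩ := hM.exists_sep_notMem ψ hwψ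
    obtain ⟨x', hxx', h'⟩ := h.back (y' := z) (hyw.trans hwz)
    exact hz (ihψ h' (hx x'.1 hxx' (ihφ h'.symm (isUpperSet_v c φ hwz hwφ))))

theorem exists_conj (hn : 1 ≤ n) (c : Colouring n M) (S : Finset (Formula n)) :
    ∃ φ : Formula n, ∀ x, x ∈ v c φ ↔ ∀ ψ ∈ S, x ∈ v c ψ := by
  classical
  induction S using Finset.induction_on with
  | empty =>
    -- There is no constant `⊤`: the empty conjunction is `p → p`, which needs a variable.
    exact ⟨.imp (.var ⟨0, hn⟩) (.var ⟨0, hn⟩), fun x => by simp [v]⟩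
  | insert ψ S _ ih =>
    obtain ⟨φ, hφ⟩ := ih
    refine ⟨.and ψ φ, fun x => ?_⟩
    rw [Finset.forall_mem_insert, ← hφ]
    rfl

/-- The set of coordinates at which the colour of a point is `false`. -/
def falseVars (c : Colouring n M) (x : M) : Finset (Fin n) :=
  Finset.univ.filter fun p => c x p = false

/-- The variable `q` for which `x` is a border point fails at `x` but holds everywhere strictly
above it. -/
theorem card_falseVars_lt {x y : Sep c} (h : x < y) :
    (falseVars c y.1).card < (falseVars c x.1).card := by
  obtain ⟨q, hq⟩ := x.2
  refine Finset.card_lt_card (Finset.ssubset_iff_of_subset ?_ |>.mpr ⟨q, ?_, ?_⟩)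
  · intro p hp
    simp only [falseVars, Finset.mem_filter, Finset.mem_univ, true_and] at hp ⊢
    by_contra hx
    have hx : x.1 ∈ v c (.var p) := Bool.eq_true_of_not_eq_false hx
    have hy : c y.1 p = true := isUpperSet_v c (.var p) h.le hx
    simp [hp] at hy
  · simpa [falseVars, v] using hq.prop
  · simpa [falseVars, v] using hq.not_prop_of_gt h

/-- The formula `φ` fails exactly at the separated points that see a point bisimilar to `z`. -/
def IsJankov (c : Colouring n M) (φ : Formula n) (z : Sep c) : Prop :=
  ∀ w : Sep c, w.1 ∉ v c φ ↔ ∃ w', w ≤ w' ∧ Bisimilar (sepColouring c) w' z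

/-- If `F` contains all variables and Jankov formulas for the points strictly above `x` and `y`,
then `x` and `y` are bisimilar as soon as they agree on `F`. -/
theorem bisimilar_of_agree {F : Finset (Formula n)} (hvar : ∀ p, Formula.var p ∈ F) {x y : Sep c}
    (hx : ∀ x', x < x' → ∃ φ ∈ F, IsJankov c φ x') (hy : ∀ y', y < y' → ∃ φ ∈ F, IsJankov c φ y')
    (h : ∀ φ ∈ F, x.1 ∈ v c φ ↔ y.1 ∈ v c φ) : Bisimilar (sepColouring c) x y := by
  refine .of_lt (funext fun p => ?_) (fun x' hx' => ?_) fun y' hy' => ?_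
  · exact Bool.eq_iff_iff.mpr (h _ (hvar p))
  · obtain ⟨φ, hφ, hJ⟩ := hx x' hx'
    have : y.1 ∉ v c φ := (h φ hφ).not.mp ((hJ x).mpr ⟨x', hx'.le, .refl _ _⟩)
    obtain ⟨y', hy', hb⟩ := (hJ y).mp this
    exact ⟨y', hy', hb.symm⟩
  · obtain ⟨φ, hφ, hJ⟩ := hy y' hy'
    exact (hJ x).mp ((h φ hφ).not.mpr ((hJ y).mpr ⟨y', hy'.le, .refl _ _⟩))

/-- Induction on the number of false variables. For a `q`-border point `z`, the formula is `⋀ S →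
q`, where `S` records which formulas of the previous stage hold at `z`. One finite set serves all
`z`, although `M^s` may be infinite. -/
theorem exists_finset_isJankov_of_card_le (hn : 1 ≤ n) (hM : HasBorders c) (k : ℕ) :
    ∃ F : Finset (Formula n), (∀ p, Formula.var p ∈ F) ∧
      ∀ z : Sep c, (falseVars c z.1).card ≤ k → ∃ φ ∈ F, IsJankov c φ z := by
  classical
  induction k with
  | zero =>
    refine ⟨Finset.univ.image Formula.var, fun p => by simp, fun z hz => ?_⟩
    obtain ⟨q, hq⟩ := z.2
    have hq' : q ∈ falseVars c z.1 := by simpa [falseVars, v] using hq.prop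
    have := Finset.card_pos.mpr ⟨q, hq'⟩
    omega
  | succ k ih =>
    obtain ⟨F, hvar, hF⟩ := ih
    choose conj hconj using exists_conj hn c
    -- At a `q`-border point, `φ → q` holds iff `φ` fails, so it stands in for the missing negation.
    let G (q : Fin n) : Finset (Formula n) := F ∪ F.image fun φ => .imp φ (.var q)
    let step (q : Fin n) : Finset (Formula n) :=
      (G q).powerset.image fun S => .imp (conj S) (.var q)
    refine ⟨F ∪ Finset.univ.biUnion step, fun p => Finset.mem_union_left _ (hvar p),
      fun z hz => ?_⟩
    obtain ⟨q, hq⟩ := z.2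
    let S := (G q).filter fun φ => z.1 ∈ v c φ
    refine ⟨.imp (conj S) (.var q), Finset.mem_union_right _ (Finset.mem_biUnion.mpr
      ⟨q, Finset.mem_univ q, Finset.mem_image_of_mem _ (Finset.mem_powerset.mpr
        (Finset.filter_subset _ _))⟩), fun w => ⟨fun hw => ?_, ?_⟩⟩
    · have ⟨y, hwy, hyS, hyq⟩ : ∃ y, w.1 ≤ y ∧ y ∈ v c (conj S) ∧ y ∉ v c (.var q) := by
        by_contra! h
        exact hw h
      obtain ⟨u, hyu, hu⟩ := hM q y hyq
      have huS := (hconj S u).mp (isUpperSet_v c _ hyu hyS)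
      have agree : ∀ φ ∈ F, u ∈ v c φ ↔ z.1 ∈ v c φ := by
        intro φ hφ
        refine ⟨fun hφu => ?_, fun hφz => ?_⟩
        · by_contra hφz
          have hz' : z.1 ∈ v c (.imp φ (.var q)) := by
            intro x hzx hx
            obtain rfl | hlt := hzx.eq_or_lt
            · exact absurd hx hφz
            · exact not_not.mp (hq.not_prop_of_gt hlt)
          exact hu.prop (huS _ (Finset.mem_filter.mpr ⟨Finset.mem_union_right _
            (Finset.mem_image_of_mem _ hφ), hz'⟩) u le_rfl hφu)
        · exact huS _ (Finset.mem_filter.mpr ⟨Finset.mem_union_left _ hφ, hφz⟩)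
      have hcu : c u = c z.1 := funext fun p => Bool.eq_iff_iff.mpr (agree _ (hvar p))
      refine ⟨⟨u, q, hu⟩, hwy.trans hyu, bisimilar_of_agree hvar (fun x' hx' => hF x' ?_)
        (fun y' hy' => hF y' ?_) agree⟩
      -- `u` has the colour of `z`, hence the same bound; points strictly above fall under the
      -- induction hypothesis.
      · have h := card_falseVars_lt hx'
        simp only [falseVars, hcu] at h hz
        exact Nat.le_of_lt_succ (h.trans_le hz)
      · exact Nat.le_of_lt_succ ((card_falseVars_lt hy').trans_le hz)
    · rintro ⟨w', hw, hb⟩ h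
      have hzS : z.1 ∈ v c (conj S) := (hconj S z.1).mpr fun φ hφ => (Finset.mem_filter.mp hφ).2
      exact hq.prop (hb.mem_v hM (.var q) (h w'.1 hw (hb.symm.mem_v hM _ hzS)))

/-- A finite set of formulas contains a Jankov formula for every separated point. -/
theorem HasBorders.exists_finset_isJankov (hn : 1 ≤ n) (hM : HasBorders c) :
    ∃ F : Finset (Formula n), ∀ z : Sep c, ∃ φ ∈ F, IsJankov c φ z := by
  obtain ⟨F, -, hF⟩ := exists_finset_isJankov_of_card_le hn hM n
  exact ⟨F, fun z => hF z ((Finset.card_le_univ _).trans_eq (Fintype.card_fin n))⟩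

/-- An up-set that is determined by its separated points, and whose separated points are closed
under bisimilarity, is definable. -/
theorem HasBorders.exists_v_eq (hn : 1 ≤ n) (hM : HasBorders c) {U : Set M} (hU : IsUpperSet U)
    (hsep : ∀ x, (∀ z : Sep c, x ≤ z.1 → z.1 ∈ U) → x ∈ U)
    (hbis : ∀ z z' : Sep c, Bisimilar (sepColouring c) z' z → z'.1 ∈ U → z.1 ∈ U) :
    ∃ φ : Formula n, v c φ = U := by
  classical
  obtain ⟨F, hF⟩ := hM.exists_finset_isJankov hn
  obtain ⟨φ, hφ⟩ := exists_conj hn c (F.filter fun ψ => ∀ z : Sep c, z.1 ∈ U → z.1 ∈ v c ψ)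
  refine ⟨φ, Set.Subset.antisymm (fun x hx => hsep x fun z hxz => ?_) fun x hx => ?_⟩
  · by_contra hz
    obtain ⟨ψ, hψF, hψ⟩ := hF z
    -- The Jankov formula of `z ∉ U` is a conjunct of `φ`: failing at some `y ∈ U` would place a
    -- copy of `z` in `U`.
    refine (hψ z).mpr ⟨z, le_rfl, .refl _ _⟩ ((hφ z.1).mp (isUpperSet_v c φ hxz hx) ψ
      (Finset.mem_filter.mpr ⟨hψF, fun y hy => ?_⟩))
    by_contra hyψ
    obtain ⟨y', hyy', hb⟩ := (hψ y).mp hyψ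
    exact hz (hbis z y' hb (hU hyy' hy))
  · by_contra hxφ
    obtain ⟨z, hxz, hz⟩ := hM.exists_sep_notMem φ hxφ
    exact hz ((hφ z.1).mpr fun ψ hψ => (Finset.mem_filter.mp hψ).2 z (hU hxz hx))

end MeetImp

theorem theorem3p14 {n : ℕ} (hn : 1 ≤ n) {M : Type*} [PartialOrder M]
    (c : MeetImp.Colouring n M) (hM : MeetImp.HasBorders c) (U : Set M) (hU : IsUpperSet U) :
    List.TFAE [
      -- (1) definability by a `(∧,→)`-formula
      ∃ φ : MeetImp.Formula n, MeetImp.v c φ = U,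
      -- (2)
      ∀ x : M,
        (∀ z : MeetImp.Sep c, x ≤ z.1 →
          ∃ y : MeetImp.Sep c, y.1 ∈ U ∧ MeetImp.Bisimilar (MeetImp.sepColouring c) y z) →
        x ∈ U,
      -- (3)
      ∀ x : M,
        ((∀ z : MeetImp.Sep c, x ≤ z.1 → z.1 ∈ U) → x ∈ U) ∧
        (∀ hx : MeetImp.IsSeparated c x,
          (∃ x' : MeetImp.Sep c, x'.1 ∈ U ∧
            MeetImp.Bisimilar (MeetImp.sepColouring c) x' ⟨x, hx⟩) → x ∈ U)] := by
  tfae_have 1 → 2 := by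
    rintro ⟨φ, rfl⟩ x hx
    by_contra h
    obtain ⟨z, hxz, hz⟩ := hM.exists_sep_notMem φ h
    obtain ⟨y, hy, hb⟩ := hx z hxz
    exact hz (hb.mem_v hM φ hy)
  tfae_have 2 → 3 := by
    refine fun h x => ⟨fun hx => h x fun z hz => ⟨z, hx z hz, .refl _ _⟩, ?_⟩
    rintro hx ⟨x', hx'U, hb⟩
    refine h x fun z hz => ?_
    obtain ⟨y, hy, hb'⟩ := hb.back (y' := z) hz
    exact ⟨y, hU hy hx'U, hb'⟩
  tfae_have 3 → 1 := fun h =>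
    hM.exists_v_eq hn hU (fun x => (h x).1) fun z z' hb hz' => (h z.1).2 z.2 ⟨z', hz', hb⟩
  tfae_finish
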